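/- **Setting.** Fix a horizon $T\ge 2$ and a finite set $\mathcal Z\subset[0,1]$. In each round $t=1,\dots,T$ a forecaster predicts $p_t\in\mathcal Z$ and simultaneously an adversary chooses a label $y_t\in\{0,1\}$; both are then revealed. A deterministic forecaster (resp. deterministic adaptive adversary) chooses $p_t$ (resp. $y_t$) as a function of the history $(p_1,y_1),\dots,(p_{t-1},y_{t-1})$. A randomized forecaster (a forecasting algorithm) $\mathfrak F$ and a randomized adaptive adversary $\mathfrak A$ are probability distributions over deterministic forecasters and over deterministic adaptive adversaries respectively; $\mathbb E$ is the expectation when $F\sim\mathfrak F$ and $A\sim\mathfrak A$ are drawn independently and played against each other. The log loss is $\ell(p,y)=y\log\frac1p+(1-y)\log\frac1{1-p}\in[0,+\infty]$ (with $0\cdot\infty=0$). The swap regret is $$\mathsf{SReg}^{\ell}=\sup_{\sigma:[0,1]\to[0,1]}\ \sum_{t=1}^T\bigl(\ell(p_t,y_t)-\ell(\sigma(p_t),y_t)\bigr),$$ where the supremum is over all functions $\sigma$. A difference $\infty-\infty$ is read as $-\infty$, so $\mathsf{SReg}^{\ell}=+\infty$ exactly if some $\ell(p_t,y_t)=+\infty$.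 The KL-calibration error is $$\mathsf{KLCal}=\sum_{p\in\mathcal Z}\ \sum_{t=1}^T \mathbf 1[p_t=p]\,\mathsf{KL}(\rho_p,p),\qquad \rho_p=\frac{\sum_{t} y_t\mathbf 1[p_t=p]}{\sum_{t}\mathbf 1[p_t=p]},$$ where $\mathsf{KL}(q,p)=q\log\frac qp+(1-q)\log\frac{1-q}{1-p}$ is the KL divergence between the Bernoulli distributions with means $q$ and $p$ (with the usual conventions), and $\rho_p=0$ if $p$ is never predicted. **Theorem.** There is an absolute constant $C>0$ such that for every $T\ge 2$ there are a finite set $\mathcal Z\subset[0,1]$ and a randomized forecaster $\mathfrak F$ with predictions in $\mathcal Z$ such that, for every randomized adaptive adversary $\mathfrak A$ (in particular, for every deterministic adaptive adversary and every oblivious adversary), $$\mathbb E\bigl[\mathsf{SReg}^{\ell}\bigr]\le C\,T^{1/3}(\log T)^{5/3}\qquad\text{and}\qquad \mathbb E\bigl[\mathsf{KLCal}\bigr]\le C\,T^{1/3}(\log T)^{5/3}.$$ -/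

import Mathlib

open scoped ENNReal unitInterval

noncomputable section

/-- Negative logarithm of a probability, with value `⊤` at `0`. -/
def negLog (x : ℝ) : EReal := -ENNReal.log (ENNReal.ofReal x)

/-- The log loss `ℓ(p, y) = y log (1/p) + (1 - y) log (1/(1 - p))`, with the label `1` encoded
as `true` and the label `0` as `false`. It takes the value `+∞` at `(0, 1)` and `(1, 0)`. -/
def logLoss (p : I) (y : Bool) : EReal :=
  if y = true then negLog (p : ℝ) else negLog (1 - (p : ℝ))

/-- The swap regret of the predictions `p` on the labels `y`: the supremum over all
swap functions `s : [0, 1] → [0, 1]` of `∑ t, (ℓ(p t, y t) - ℓ(s(p t), y t))`.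

If `ℓ` is the log loss, this lies in `[0, +∞]` and it is `+∞` exactly if some prediction
incurs infinite loss (the difference `⊤ - ⊤` is `⊥`, so it never enlarges the supremum). -/
def swapRegret (ℓ : I → Bool → EReal) {T : ℕ} (p : Fin T → I) (y : Fin T → Bool) : EReal :=
  ⨆ s : I → I, ∑ t, (ℓ (p t) (y t) - ℓ (s (p t)) (y t))

/-- The KL divergence `q log (q/p) + (1 - q) log ((1 - q)/(1 - p))` of the Bernoulli distributions
with means `q, p ∈ [0, 1]`. The conventions are the usual ones: `0 log (0/p) = 0`, also for `p = 0`,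
and `q log (q/0) = +∞` for `q > 0`. -/
def bernoulliKL (q p : ℝ) : EReal :=
  (q : EReal) * ENNReal.log (ENNReal.ofReal q / ENNReal.ofReal p) +
    ((1 - q : ℝ) : EReal) * ENNReal.log (ENNReal.ofReal (1 - q) / ENNReal.ofReal (1 - p))

/-- The empirical frequency `ρ_x` of the label `1` among the rounds with prediction `x`
(`0` if there are none). -/
def empiricalFreq {T : ℕ} (p : Fin T → I) (y : Fin T → Bool) (x : I) : ℝ :=
  (∑ t, if p t = x ∧ y t = true then (1 : ℝ) else 0) / (∑ t, if p t = x then (1 : ℝ) else 0)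

/-- The KL-calibration error of predictions `p` from the finite set `Z`. -/
def klCal (Z : Finset I) {T : ℕ} (p : Fin T → I) (y : Fin T → Bool) : EReal :=
  ∑ x ∈ Z, ∑ t, if p t = x then bernoulliKL (empiricalFreq p y x) (x : ℝ) else 0

/-- The history of the first `t` rounds: the pairs of predictions and labels. -/
abbrev History (Z : Finset I) (t : ℕ) : Type := Fin t → Z × Bool

/-- A deterministic forecaster over `T` rounds with predictions in `Z`: in each round it chooses
the prediction as a function of the past predictions and labels. -/
abbrev Forecaster (Z : Finset I) (T : ℕ) : Type := (t : Fin T) → History Z t → Z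

/-- A deterministic adaptive adversary over `T` rounds: in each round it chooses the label
as a function of the past predictions and labels. -/
abbrev Adversary (Z : Finset I) (T : ℕ) : Type := (t : Fin T) → History Z t → Bool

/-- The history after the first `t` rounds when `F` plays against `A`; in each round both
move simultaneously. -/
def play {Z : Finset I} {T : ℕ} (F : Forecaster Z T) (A : Adversary Z T) :
    (t : ℕ) → t ≤ T → History Z t
  | 0, _ => Fin.elim0
  | t + 1, h =>
    let H : History Z t := play F A t (Nat.le_of_succ_le h)
    Fin.snoc H (F ⟨t, h⟩ H, A ⟨t, h⟩ H)

/-- The predictions made when `F` plays `T` rounds against `A`. -/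
def predictions {Z : Finset I} {T : ℕ} (F : Forecaster Z T) (A : Adversary Z T) : Fin T → I :=
  fun t => (play F A T le_rfl t).1

/-- The labels chosen when `F` plays `T` rounds against `A`. -/
def labels {Z : Finset I} {T : ℕ} (F : Forecaster Z T) (A : Adversary Z T) : Fin T → Bool :=
  fun t => (play F A T le_rfl t).2

/-- The expectation of `X(F, A)`, for `X` with values in `[0, +∞]`, if a randomized forecaster draws
`F` from `P` and, independently, a randomized adversary draws `A` from `Q`. -/
def expectation {Z : Finset I} {T : ℕ} (P : PMF (Forecaster Z T)) (Q : PMF (Adversary Z T))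
    (X : Forecaster Z T → Adversary Z T → EReal) : ℝ≥0∞ :=
  ∑' F, ∑' A, P F * Q A * (X F A).toENNReal

end

/-!
The payoffs are bounded by one real number. Both the KL-calibration error and, by a termwise
Gibbs inequality, the swap regret of the log loss are at most the `χ²`-calibration error
`W = ∑ x ∈ Z, (m x - n x * x) ^ 2 / (n x * x * (1 - x))`, where `n x` is the number of rounds with
prediction `x` and `m x` the number of those with label `1` (`klCal_le_chiSqCal`,
`swapRegret_le_chiSqCal`). The predictions in `Z` avoid `0` and `1`, so everything is finite.

The game with payoff `W` is finite, so by the minimax theorem (`exists_mixed_strategy_le`) it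
suffices to answer a known distribution of the adversaries. Then the forecaster knows the
conditional probability `q` of the label `1` and predicts a nearby grid point `x`. The decisive
estimate is `chiSq_step`: the mean growth of the summand of `x` in one round is at most
`((q - x) ^ 2 + q * (1 - q) / (n x + 1)) / (x * (1 - x))`. The accumulated deviation does not
enter, because the growth of the denominator pays for the cross term; hence no maximal inequality
or martingale concentration is needed.

The grid `varianceGrid K` has at most `2 K` points. Its mesh near `x` is of the order of
`√(x (1 - x)) / K`, so the bias term is at most `9 / K ^ 2`, and `q * (1 - q) ≤ 8 * (x * (1 - x))`.
The variance terms of one grid point form a harmonic sum; it is subtracted from `W` to give the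
potential `calPotential`, whose mean grows by at most `9 / K ^ 2` in a round. In total, the mean
of `W` is at most `9 T / K ^ 2 + 16 K (1 + log T)`, and `K = ⌈T ^ (1 / 3)⌉` gives a multiple of
`T ^ (1 / 3) * (1 + log T)`. Since `log T ≥ 1 / 2`, this is within the claimed bound (`rate_le`).
-/

/-! ### Finite zero-sum games -/

/-- The minimax theorem for a finite game with loss matrix `M`: if every mixed strategy of the
maximizer has a pure response of loss at most `v`, then some mixed strategy of the minimizer has
loss at most `v` against everything. -/
lemma exists_mixed_strategy_le {ι κ : Type*} [Fintype ι] [Fintype κ] [Nonempty κ]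
    (M : ι → κ → ℝ) (v : ℝ)
    (h : ∀ w ∈ stdSimplex ℝ κ, ∃ i, ∑ j, w j * M i j ≤ v) :
    ∃ u ∈ stdSimplex ℝ ι, ∀ j, ∑ i, u i * M i j ≤ v := by
  classical
  have hY : (stdSimplex ℝ κ).Nonempty := ⟨_, single_mem_stdSimplex ℝ (Classical.arbitrary κ)⟩
  obtain ⟨w₀, hw₀⟩ := hY
  obtain ⟨i₀, -⟩ := h w₀ hw₀
  have hX : (stdSimplex ℝ ι).Nonempty := ⟨_, single_mem_stdSimplex ℝ i₀⟩
  let f : (ι → ℝ) → (κ → ℝ) → ℝ := fun u w => ∑ i, ∑ j, u i * w j * M i j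
  have hfy (w : κ → ℝ) : IsLinearMap ℝ (fun u => f u w) := by
    refine ⟨fun x y => ?_, fun c x => ?_⟩
    · simp only [f, Pi.add_apply, add_mul, Finset.sum_add_distrib]
    · simp only [f, Pi.smul_apply, smul_eq_mul, Finset.mul_sum, mul_assoc]
  have hfx (u : ι → ℝ) : IsLinearMap ℝ (fun w => f u w) := by
    refine ⟨fun x y => ?_, fun c x => ?_⟩
    · simp only [f, Pi.add_apply, add_mul, mul_add, Finset.sum_add_distrib]
    · simp only [f, Pi.smul_apply, smul_eq_mul, Finset.mul_sum]
      exact Finset.sum_congr rfl fun i _ => Finset.sum_congr rfl fun j _ => by ring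
  obtain ⟨u, hu, w, hw, huw⟩ := Sion.exists_isSaddlePointOn' (f := f)
    hX (isCompact_stdSimplex ℝ ι)
    (fun w _ => (Continuous.continuousOn (by fun_prop)).lowerSemicontinuousOn)
    (fun w _ => ((hfy w).mk' _ |>.convexOn (convex_stdSimplex ℝ ι)).quasiconvexOn)
    (convex_stdSimplex ℝ κ) (isCompact_stdSimplex ℝ κ)
    (fun u _ => (Continuous.continuousOn (by fun_prop)).upperSemicontinuousOn)
    (fun u _ => ((hfx u).mk' _ |>.concaveOn (convex_stdSimplex ℝ κ)).quasiconcaveOn)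
    (convex_stdSimplex ℝ ι) ⟨w₀, hw₀⟩
  obtain ⟨i, hi⟩ := h w hw
  refine ⟨u, hu, fun j => ?_⟩
  have key := huw _ (single_mem_stdSimplex ℝ i) _ (single_mem_stdSimplex ℝ j)
  have h1 : f u (Pi.single j 1) = ∑ i, u i * M i j := by
    simp [f, Pi.single_apply]
  have h2 : f (Pi.single i 1) w = ∑ j, w j * M i j := by
    simp only [f, Pi.single_apply, ite_mul, one_mul, zero_mul]
    rw [Finset.sum_comm]
    simp
  rw [h1, h2] at key
  exact key.trans hi

/-! ### Playing against a known distribution of adversaries -/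

section play

variable {Z : Finset I} {T : ℕ}

lemma play_congr {F F' : Forecaster Z T} (A : Adversary Z T) (t : ℕ) (ht : t ≤ T)
    (h : ∀ s : Fin T, (s : ℕ) < t → F s = F' s) : play F A t ht = play F' A t ht := by
  induction t with
  | zero => rfl
  | succ t ih =>
    have e := ih (Nat.le_of_succ_le ht) fun s hs => h s (hs.trans (Nat.lt_succ_self t))
    simp only [play]
    rw [e, h ⟨t, ht⟩ (Nat.lt_succ_self t)]

/-- If every pair of masses of the two labels has a prediction that keeps the mean growth of the
potential `Φ` below `c` in a single round, then a forecaster who knows the weights `w` of the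
adversaries keeps the mean growth below `c` in all rounds. The forecaster answers a history with
the prediction for the masses, among the adversaries that lead to this history, of the two
next labels. -/
lemma exists_forecaster_potential_le (Φ : (t : ℕ) → History Z t → ℝ) (c : ℝ)
    (hΦ : ∀ (t : ℕ) (h : History Z t) (a b : ℝ), 0 ≤ a → 0 ≤ b → ∃ x : Z,
      a * Φ (t + 1) (Fin.snoc (α := fun _ => Z × Bool) h (x, true)) +
        b * Φ (t + 1) (Fin.snoc (α := fun _ => Z × Bool) h (x, false)) ≤ (a + b) * (Φ t h + c))
    (w : Adversary Z T → ℝ) (hw : ∀ A, 0 ≤ w A) [Nonempty Z] (t : ℕ) (ht : t ≤ T) :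
    ∃ F : Forecaster Z T,
      ∑ A, w A * Φ t (play F A t ht) ≤ (∑ A, w A) * (Φ 0 Fin.elim0 + t * c) := by
  classical
  induction t with
  | zero => exact ⟨fun _ _ => Classical.arbitrary Z, by simp [play, Finset.sum_mul]⟩
  | succ t ih =>
    obtain ⟨F, hF⟩ := ih (Nat.le_of_succ_le ht)
    let τ : Fin T := ⟨t, ht⟩
    let H : Adversary Z T → History Z t := fun A => play F A t (Nat.le_of_succ_le ht)
    -- the masses of the next labels at the history `h`
    let m (h : History Z t) (y : Bool) : ℝ := ∑ A with H A = h, if A τ h = y then w A else 0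
    have hm (h y) : 0 ≤ m h y := Finset.sum_nonneg fun A _ => by split_ifs <;> simp [hw A]
    choose g hg using fun h : History Z t => hΦ t h (m h true) (m h false) (hm h _) (hm h _)
    let F' : Forecaster Z T := Function.update F τ g
    have hH (A) : play F' A t (Nat.le_of_succ_le ht) = H A :=
      play_congr A t _ fun s hs => Function.update_of_ne (fun e => by simp [e, τ] at hs) _ _
    have hplay (A) : play F' A (t + 1) ht =
        Fin.snoc (α := fun _ => Z × Bool) (H A) (g (H A), A τ (H A)) := by
      simp only [play, hH]
      simp [F', τ]
    refine ⟨F', ?_⟩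
    have hfib (f : Adversary Z T → ℝ) : ∑ A, f A = ∑ h, ∑ A with H A = h, f A :=
      (Finset.sum_fiberwise _ _ _).symm
    have hstep (h : History Z t) : ∑ A with H A = h, w A * Φ (t + 1) (play F' A (t + 1) ht) ≤
        ∑ A with H A = h, w A * (Φ t (H A) + c) := by
      have e1 : ∑ A with H A = h, w A * Φ (t + 1) (play F' A (t + 1) ht) =
          m h true * Φ (t + 1) (Fin.snoc (α := fun _ => Z × Bool) h (g h, true)) +
          m h false * Φ (t + 1) (Fin.snoc (α := fun _ => Z × Bool) h (g h, false)) := by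
        simp only [m, Finset.sum_mul]
        rw [← Finset.sum_add_distrib]
        refine Finset.sum_congr rfl fun A hA => ?_
        rw [Finset.mem_filter] at hA
        rw [hplay, hA.2]
        cases A τ h <;> simp
      have e2 : ∑ A with H A = h, w A * (Φ t (H A) + c) =
          (m h true + m h false) * (Φ t h + c) := by
        simp only [m]
        rw [← Finset.sum_add_distrib, Finset.sum_mul]
        refine Finset.sum_congr rfl fun A hA => ?_
        rw [Finset.mem_filter] at hA
        rw [hA.2]
        cases A τ h <;> simp
      rw [e1, e2]
      exact hg h
    calc ∑ A, w A * Φ (t + 1) (play F' A (t + 1) ht)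
        ≤ ∑ A, w A * (Φ t (H A) + c) := by
          rw [hfib, hfib fun A => w A * (Φ t (H A) + c)]
          exact Finset.sum_le_sum fun h _ => hstep h
      _ = ∑ A, w A * Φ t (H A) + (∑ A, w A) * c := by
          simp only [mul_add, Finset.sum_add_distrib, Finset.sum_mul]
      _ ≤ (∑ A, w A) * (Φ 0 Fin.elim0 + t * c) + (∑ A, w A) * c := by
          linarith [hF]
      _ = (∑ A, w A) * (Φ 0 Fin.elim0 + (t + 1 : ℕ) * c) := by push_cast; ring

end play

/-! ### A grid adapted to the variance of Bernoulli distributions -/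

/-- The grid of the points `i² / (2K²)`, for `1 ≤ i ≤ K`, and their mirror images at `1/2`. Near
`x` its mesh is of the order of `√(x(1 - x)) / K`. -/
noncomputable def varianceGrid (K : ℕ) : Finset I :=
  let p : ℕ → I := fun i => Set.projIcc 0 1 zero_le_one ((i : ℝ) ^ 2 / (2 * (K : ℝ) ^ 2))
  (Finset.Icc 1 K).image p ∪ (Finset.Icc 1 K).image fun i => σ (p i)

lemma card_varianceGrid_le (K : ℕ) : (varianceGrid K).card ≤ 2 * K := by
  refine (Finset.card_union_le _ _).trans ?_
  have h1 := Finset.card_image_le (s := Finset.Icc 1 K)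
    (f := fun i : ℕ => (Set.projIcc 0 1 zero_le_one ((i : ℝ) ^ 2 / (2 * (K : ℝ) ^ 2)) : I))
  have h2 := Finset.card_image_le (s := Finset.Icc 1 K)
    (f := fun i : ℕ => σ (Set.projIcc 0 1 zero_le_one ((i : ℝ) ^ 2 / (2 * (K : ℝ) ^ 2)) : I))
  rw [Nat.card_Icc] at h1 h2
  simp only at h1 h2 ⊢
  omega

lemma coe_projIcc_grid {K i : ℕ} (h1 : 1 ≤ i) (hK : i ≤ K) :
    ((Set.projIcc 0 1 zero_le_one ((i : ℝ) ^ 2 / (2 * (K : ℝ) ^ 2)) : I) : ℝ) =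
      (i : ℝ) ^ 2 / (2 * (K : ℝ) ^ 2) ∧
    0 < (i : ℝ) ^ 2 / (2 * (K : ℝ) ^ 2) ∧ (i : ℝ) ^ 2 / (2 * (K : ℝ) ^ 2) ≤ 1 / 2 := by
  have hi : (1 : ℝ) ≤ i := by exact_mod_cast h1
  have hiK : (i : ℝ) ≤ K := by exact_mod_cast hK
  have h0 : 0 < (i : ℝ) ^ 2 / (2 * (K : ℝ) ^ 2) := by
    have : (0 : ℝ) < K := by linarith
    positivity
  have h2 : (i : ℝ) ^ 2 / (2 * (K : ℝ) ^ 2) ≤ 1 / 2 := by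
    rw [div_le_div_iff₀ (by nlinarith) two_pos]
    nlinarith
  refine ⟨?_, h0, h2⟩
  rw [Set.projIcc_of_mem zero_le_one ⟨h0.le, by linarith⟩]

lemma pos_and_lt_one_of_mem_varianceGrid {K : ℕ} {x : I} (hx : x ∈ varianceGrid K) :
    0 < (x : ℝ) ∧ (x : ℝ) < 1 := by
  simp only [varianceGrid, Finset.mem_union, Finset.mem_image, Finset.mem_Icc] at hx
  rcases hx with ⟨i, ⟨h1, h2⟩, rfl⟩ | ⟨i, ⟨h1, h2⟩, rfl⟩
  · obtain ⟨e, h0, hh⟩ := coe_projIcc_grid h1 h2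
    rw [e]
    constructor <;> linarith
  · obtain ⟨e, h0, hh⟩ := coe_projIcc_grid h1 h2
    rw [unitInterval.coe_symm_eq, e]
    constructor <;> linarith

/-- The grid point below `q ∈ [0, 1/2]` (the smallest one if there is none). -/
lemma exists_sq_grid_near {K : ℕ} (hK : 1 ≤ K) {q : ℝ} (h0 : 0 ≤ q) (hq : q ≤ 1 / 2) :
    ∃ i : ℕ, 1 ≤ i ∧ i ≤ K ∧ ∀ x : ℝ, x = (i : ℝ) ^ 2 / (2 * (K : ℝ) ^ 2) →
      (q - x) ^ 2 ≤ 9 / (K : ℝ) ^ 2 * (x * (1 - x)) ∧ q * (1 - q) ≤ 8 * (x * (1 - x)) := by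
  have hK0 : (0 : ℝ) < K := by exact_mod_cast hK
  set r : ℝ := K * √(2 * q) with hr
  have hr0 : 0 ≤ r := by positivity
  have hrq : q = r ^ 2 / (2 * (K : ℝ) ^ 2) := by
    rw [hr, mul_pow, Real.sq_sqrt (by linarith)]
    field_simp
  have hrK : r ≤ K := by
    have : √(2 * q) ≤ 1 := Real.sqrt_le_one.mpr (by linarith)
    nlinarith
  have hfl : ⌊r⌋₊ ≤ K := Nat.floor_le_of_le hrK
  refine ⟨max 1 ⌊r⌋₊, le_max_left _ _, max_le hK hfl, fun x hx => ?_⟩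
  set i : ℝ := ((max 1 ⌊r⌋₊ : ℕ) : ℝ) with hi
  have hi1 : 1 ≤ i := by rw [hi]; exact_mod_cast le_max_left _ _
  have hiK : i ≤ K := by rw [hi]; exact_mod_cast max_le hK hfl
  have hri : r ≤ i + 1 := by
    have h1 := (Nat.lt_floor_add_one r).le
    have h2 : ((⌊r⌋₊ : ℕ) : ℝ) ≤ i := by rw [hi]; exact_mod_cast le_max_right _ _
    linarith
  have hir : i ^ 2 ≤ r ^ 2 + 3 * i := by
    rcases le_total 1 ⌊r⌋₊ with h | h
    · have : i ≤ r := by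
        rw [hi, max_eq_right h]
        exact Nat.floor_le hr0
      nlinarith
    · have : i = 1 := by rw [hi, max_eq_left h]; simp
      rw [this]
      nlinarith
  have hD : (0 : ℝ) < 2 * (K : ℝ) ^ 2 := by positivity
  have hx2 : x ≤ 1 / 2 := by
    rw [hx, div_le_div_iff₀ hD two_pos]
    nlinarith
  have hx0 : 0 ≤ x := by rw [hx]; positivity
  have hxx : x / 2 ≤ x * (1 - x) := by nlinarith
  have habs : |q - x| ≤ 3 * i / (2 * (K : ℝ) ^ 2) := by
    rw [hrq, hx, ← sub_div, abs_div, abs_of_pos hD]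
    gcongr
    rw [abs_le]
    constructor <;> nlinarith
  constructor
  · calc (q - x) ^ 2 = |q - x| ^ 2 := (sq_abs _).symm
      _ ≤ (3 * i / (2 * (K : ℝ) ^ 2)) ^ 2 := by gcongr
      _ = 9 / (K : ℝ) ^ 2 * (x / 2) := by rw [hx]; field_simp; ring
      _ ≤ 9 / (K : ℝ) ^ 2 * (x * (1 - x)) := by gcongr
  · have h4 : q ≤ 4 * x := by
      rw [hrq, hx, ← mul_div_assoc]
      gcongr
      nlinarith
    nlinarith

lemma exists_mem_varianceGrid_near {K : ℕ} (hK : 1 ≤ K) {q : ℝ} (h0 : 0 ≤ q) (h1 : q ≤ 1) :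
    ∃ x ∈ varianceGrid K, (q - (x : ℝ)) ^ 2 ≤ 9 / (K : ℝ) ^ 2 * ((x : ℝ) * (1 - x)) ∧
      q * (1 - q) ≤ 8 * ((x : ℝ) * (1 - x)) := by
  rcases le_total q (1 / 2) with hq | hq
  · obtain ⟨i, hi1, hiK, h⟩ := exists_sq_grid_near hK h0 hq
    refine ⟨_, Finset.mem_union_left _
      (Finset.mem_image_of_mem _ (Finset.mem_Icc.mpr ⟨hi1, hiK⟩)), ?_⟩
    exact h _ (coe_projIcc_grid hi1 hiK).1
  · obtain ⟨i, hi1, hiK, h⟩ := exists_sq_grid_near hK (q := 1 - q) (by linarith) (by linarith)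
    refine ⟨_, Finset.mem_union_right _
      (Finset.mem_image_of_mem _ (Finset.mem_Icc.mpr ⟨hi1, hiK⟩)), ?_⟩
    obtain ⟨ha, hb⟩ := h _ (coe_projIcc_grid hi1 hiK).1
    rw [unitInterval.coe_symm_eq]
    constructor
    · convert ha using 1 <;> ring
    · convert hb using 1 <;> ring

/-! ### The chi-squared potential -/

/-- The weighted `χ²` divergence `n (ρ - x)² / (x (1 - x))`, where `ρ = m / n`, of `n` labels with
`m` ones from the prediction `x`. It is `0` for `n = 0`. -/
noncomputable def chiSq (n m : ℕ) (x : ℝ) : ℝ := ((m : ℝ) - n * x) ^ 2 / (n * (x * (1 - x)))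

lemma chiSq_nonneg (n m : ℕ) {x : ℝ} (h0 : 0 < x) (h1 : x < 1) : 0 ≤ chiSq n m x := by
  have : 0 < 1 - x := by linarith
  unfold chiSq
  positivity

/-- If the next label has mean `q`, then its mean effect on the `χ²` divergence from `x` is at
most the squared bias `(q - x)²` plus a `1 / (n + 1)` share of the variance, both relative
to `x (1 - x)`. The cross term between the bias and the accumulated deviation is absorbed by the
growth of the denominator from `n` to `n + 1`. -/
lemma chiSq_step {n m : ℕ} (hmn : m ≤ n) {x q B V : ℝ} (h0 : 0 < x) (h1 : x < 1)
    (hB : (q - x) ^ 2 ≤ B * (x * (1 - x))) (hV : q * (1 - q) ≤ V * (x * (1 - x))) :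
    q * chiSq (n + 1) (m + 1) x + (1 - q) * chiSq (n + 1) m x ≤
      chiSq n m x + B + V / (n + 1) := by
  have hD : 0 < x * (1 - x) := mul_pos h0 (by linarith)
  have hn1 : (0 : ℝ) < n + 1 := by positivity
  set D := x * (1 - x) with hDdef
  set S : ℝ := (m : ℝ) - n * x with hS
  have e : q * chiSq (n + 1) (m + 1) x + (1 - q) * chiSq (n + 1) m x =
      (S ^ 2 + 2 * S * (q - x) + q * (1 - q) + (q - x) ^ 2) / ((n + 1) * D) := by
    unfold chiSq
    rw [← hDdef, hS]
    push_cast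
    field_simp
    ring
  have key : S ^ 2 + 2 * S * (q - x) ≤ (n + 1) * (D * chiSq n m x) + n * (q - x) ^ 2 := by
    rcases Nat.eq_zero_or_pos n with rfl | hn
    · have : S = 0 := by rw [hS]; simp [Nat.le_zero.mp hmn]
      simp [this, chiSq]
    · have hn' : (0 : ℝ) < n := by exact_mod_cast hn
      have e2 : D * chiSq n m x = S ^ 2 / n := by
        unfold chiSq
        rw [← hDdef, ← hS]
        field_simp
      have e3 : (n + 1) * (S ^ 2 / n) + n * (q - x) ^ 2 - (S ^ 2 + 2 * S * (q - x)) =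
          (S - n * (q - x)) ^ 2 / n := by
        field_simp
        ring
      have : 0 ≤ (S - n * (q - x)) ^ 2 / n := by positivity
      rw [e2]
      linarith
  rw [e, div_le_iff₀ (by positivity)]
  have e4 : (chiSq n m x + B + V / (n + 1)) * ((n + 1) * D) =
      (n + 1) * (D * chiSq n m x) + (n + 1) * (B * D) + V * D := by
    field_simp
  rw [e4]
  nlinarith

/-! ### Bounds by the chi-squared divergence -/

/-- The number of rounds with prediction `x`. -/
noncomputable def predCount {T : ℕ} (p : Fin T → I) (x : I) : ℕ := ∑ t, if p t = x then 1 else 0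

/-- The number of rounds with prediction `x` and label `1`. -/
noncomputable def oneCount {T : ℕ} (p : Fin T → I) (y : Fin T → Bool) (x : I) : ℕ :=
  ∑ t, if p t = x ∧ y t = true then 1 else 0

/-- The `χ²`-calibration error: the squared deviations of the empirical frequencies from the
predictions in `Z`, weighted by the inverse variances and by the numbers of rounds. -/
noncomputable def chiSqCal (Z : Finset I) {T : ℕ} (p : Fin T → I) (y : Fin T → Bool) : ℝ :=
  ∑ x ∈ Z, chiSq (predCount p x) (oneCount p y x) x

section counts

variable {T : ℕ} (p : Fin T → I) (y : Fin T → Bool) (x : I)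

lemma oneCount_le_predCount : oneCount p y x ≤ predCount p x := by
  refine Finset.sum_le_sum fun t _ => ?_
  by_cases h : p t = x <;> by_cases h' : y t = true <;> simp [h, h']

lemma predCount_le : predCount p x ≤ T := by
  calc predCount p x ≤ ∑ _t : Fin T, 1 := Finset.sum_le_sum fun t _ => by split_ifs <;> simp
    _ = T := by simp

lemma empiricalFreq_eq : empiricalFreq p y x = (oneCount p y x : ℝ) / predCount p x := by
  simp [empiricalFreq, oneCount, predCount]

lemma empiricalFreq_nonneg : 0 ≤ empiricalFreq p y x := by
  rw [empiricalFreq_eq]; positivity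

lemma empiricalFreq_le_one : empiricalFreq p y x ≤ 1 := by
  rw [empiricalFreq_eq]
  exact div_le_one_of_le₀ (by exact_mod_cast oneCount_le_predCount p y x) (by positivity)

lemma predCount_mul_empiricalFreq : predCount p x * empiricalFreq p y x = oneCount p y x := by
  rcases Nat.eq_zero_or_pos (predCount p x) with h | h
  · have := oneCount_le_predCount p y x
    simp [h, show oneCount p y x = 0 by omega]
  · rw [empiricalFreq_eq]
    field_simp

lemma chiSq_eq_empiricalFreq {x : I} (h0 : 0 < (x : ℝ)) (h1 : (x : ℝ) < 1) :
    chiSq (predCount p x) (oneCount p y x) x =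
      predCount p x * ((empiricalFreq p y x - x) ^ 2 / (x * (1 - x))) := by
  have : (0 : ℝ) < 1 - x := by linarith
  rw [chiSq, ← predCount_mul_empiricalFreq]
  rcases Nat.eq_zero_or_pos (predCount p x) with h | h
  · simp [h]
  · field_simp

/-- A sum over the rounds, grouped by prediction and label. -/
lemma sum_eq_sum_counts {Z : Finset I} (hp : ∀ t, p t ∈ Z) (f : I → Bool → ℝ) :
    ∑ t, f (p t) (y t) = ∑ x ∈ Z, ((oneCount p y x : ℝ) * f x true +
      ((predCount p x : ℝ) - oneCount p y x) * f x false) := by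
  have h (t) : f (p t) (y t) = ∑ x ∈ Z, if p t = x then f x (y t) else 0 := by
    rw [Finset.sum_ite_eq]; simp [hp t]
  simp_rw [h]
  rw [Finset.sum_comm]
  refine Finset.sum_congr rfl fun x _ => ?_
  simp only [oneCount, predCount]
  push_cast
  rw [← Finset.sum_sub_distrib, Finset.sum_mul, Finset.sum_mul, ← Finset.sum_add_distrib]
  refine Finset.sum_congr rfl fun t _ => ?_
  by_cases h : p t = x <;> cases h' : y t <;> simp [h]

end counts

lemma ereal_coe_sum {ι : Type*} (s : Finset ι) (f : ι → ℝ) :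
    ((∑ i ∈ s, f i : ℝ) : EReal) = ∑ i ∈ s, (f i : EReal) := by
  classical
  induction s using Finset.induction_on with
  | empty => simp
  | insert a s ha ih => rw [Finset.sum_insert ha, Finset.sum_insert ha, EReal.coe_add, ih]

lemma coe_mul_log_div_le {q p : ℝ} (hq : 0 ≤ q) (hp : 0 < p) :
    (q : EReal) * ENNReal.log (ENNReal.ofReal q / ENNReal.ofReal p) ≤
      ((q * (q / p - 1) : ℝ) : EReal) := by
  rcases hq.eq_or_lt with rfl | hq
  · simp
  · rw [← ENNReal.ofReal_div_of_pos hp, ENNReal.log_ofReal_of_pos (by positivity),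
      ← EReal.coe_mul, EReal.coe_le_coe_iff]
    gcongr
    exact Real.log_le_sub_one_of_pos (by positivity)

/-- The KL divergence is at most the `χ²` divergence. -/
lemma bernoulliKL_le {q p : ℝ} (hq0 : 0 ≤ q) (hq1 : q ≤ 1) (hp0 : 0 < p) (hp1 : p < 1) :
    bernoulliKL q p ≤ (((q - p) ^ 2 / (p * (1 - p)) : ℝ) : EReal) := by
  have hp1' : 0 < 1 - p := by linarith
  refine (add_le_add (coe_mul_log_div_le hq0 hp0)
    (coe_mul_log_div_le (sub_nonneg.mpr hq1) hp1')).trans ?_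
  rw [← EReal.coe_add, EReal.coe_le_coe_iff]
  apply le_of_eq
  field_simp
  ring

lemma klCal_le_chiSqCal {Z : Finset I} (hZ : ∀ x ∈ Z, 0 < (x : ℝ) ∧ (x : ℝ) < 1) {T : ℕ}
    (p : Fin T → I) (y : Fin T → Bool) : klCal Z p y ≤ (chiSqCal Z p y : EReal) := by
  rw [klCal, chiSqCal, ereal_coe_sum]
  refine Finset.sum_le_sum fun x hx => ?_
  obtain ⟨h0, h1⟩ := hZ x hx
  rw [chiSq_eq_empiricalFreq p y h0 h1, predCount, Nat.cast_sum, Finset.sum_mul, ereal_coe_sum]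
  refine Finset.sum_le_sum fun t _ => ?_
  split_ifs
  · rw [Nat.cast_one, one_mul]
    exact bernoulliKL_le (empiricalFreq_nonneg p y x) (empiricalFreq_le_one p y x) h0 h1
  · simp

/-- A linearized Gibbs inequality. It also holds for `r = 0`, where the left side is `⊥`; the
linear right side makes the terms of a sum add up without a case distinction. -/
lemma negLog_sub_negLog_le {x r ρ : ℝ} (hx : 0 < x) (hρ : 0 < ρ) (hr : 0 ≤ r) :
    negLog x - negLog r ≤ ((ρ / x + r / ρ - 2 : ℝ) : EReal) := by
  unfold negLog
  rw [ENNReal.log_ofReal_of_pos hx]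
  rcases hr.eq_or_lt with rfl | hr
  · rw [← EReal.coe_neg]
    simp
  · rw [ENNReal.log_ofReal_of_pos hr, ← EReal.coe_neg, ← EReal.coe_neg, ← EReal.coe_sub,
      EReal.coe_le_coe_iff]
    have h1 := Real.log_le_sub_one_of_pos (div_pos hρ hx)
    have h2 := Real.log_le_sub_one_of_pos (div_pos hr hρ)
    rw [Real.log_div hρ.ne' hx.ne'] at h1
    rw [Real.log_div hr.ne' hρ.ne'] at h2
    linarith

lemma swapRegret_le_chiSqCal {Z : Finset I} (hZ : ∀ x ∈ Z, 0 < (x : ℝ) ∧ (x : ℝ) < 1) {T : ℕ}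
    (p : Fin T → I) (y : Fin T → Bool) (hp : ∀ t, p t ∈ Z) :
    swapRegret logLoss p y ≤ (chiSqCal Z p y : EReal) := by
  refine iSup_le fun s => ?_
  let ρ : I → ℝ := fun x => empiricalFreq p y x
  let f : I → Bool → ℝ := fun x b =>
    if b = true then ρ x / x + s x / ρ x - 2
    else (1 - ρ x) / (1 - x) + (1 - s x) / (1 - ρ x) - 2
  have hterm (t : Fin T) :
      logLoss (p t) (y t) - logLoss (s (p t)) (y t) ≤ (f (p t) (y t) : EReal) := by
    obtain ⟨h0, h1⟩ := hZ _ (hp t)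
    have hn : 0 < predCount p (p t) := by
      refine lt_of_lt_of_le zero_lt_one (le_trans ?_ (Finset.single_le_sum
        (fun _ _ => Nat.zero_le _) (Finset.mem_univ t)))
      simp
    cases hy : y t
    · have hlt : oneCount p y (p t) < predCount p (p t) := by
        refine Finset.sum_lt_sum (fun u _ => ?_) ⟨t, Finset.mem_univ t, by simp [hy]⟩
        by_cases h : p u = p t <;> by_cases h' : y u = true <;> simp [h, h']
      have hρ : ρ (p t) < 1 := by
        simp only [ρ]
        rw [empiricalFreq_eq, div_lt_one (by exact_mod_cast hn)]
        exact_mod_cast hlt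
      simpa [logLoss, f] using
        negLog_sub_negLog_le (sub_pos.mpr h1) (sub_pos.mpr hρ) (sub_nonneg.mpr (s (p t)).2.2)
    · have hpos : 0 < oneCount p y (p t) := by
        refine lt_of_lt_of_le zero_lt_one (le_trans ?_ (Finset.single_le_sum
          (fun _ _ => Nat.zero_le _) (Finset.mem_univ t)))
        simp [hy]
      have hρ : 0 < ρ (p t) := by
        simp only [ρ]
        rw [empiricalFreq_eq]
        positivity
      simpa [logLoss, f] using negLog_sub_negLog_le h0 hρ (s (p t)).2.1
  refine (Finset.sum_le_sum fun t _ => hterm t).trans ?_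
  rw [← ereal_coe_sum, EReal.coe_le_coe_iff, sum_eq_sum_counts p y hp, chiSqCal]
  refine Finset.sum_le_sum fun x hx => ?_
  obtain ⟨h0, h1⟩ := hZ x hx
  have h1' : 0 < 1 - (x : ℝ) := by linarith
  rw [chiSq_eq_empiricalFreq p y h0 h1, ← predCount_mul_empiricalFreq p y x]
  have e : (predCount p x : ℝ) * empiricalFreq p y x * f x true +
      (predCount p x - predCount p x * empiricalFreq p y x) * f x false =
      predCount p x * (ρ x * f x true + (1 - ρ x) * f x false) := by
    simp only [ρ]; ring
  rw [e]
  gcongr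
  -- the weights `ρ` and `1 - ρ` cancel the denominators, unless they vanish
  have ha : ρ x * (s x / ρ x) ≤ s x := by
    rcases eq_or_ne (ρ x) 0 with h | h
    · simp [h, (s x).2.1]
    · rw [mul_div_cancel₀ _ h]
  have hb : (1 - ρ x) * ((1 - s x) / (1 - ρ x)) ≤ 1 - s x := by
    rcases eq_or_ne (1 - ρ x) 0 with h | h
    · simp [h, (s x).2.2]
    · rw [mul_div_cancel₀ _ h]
  have e2 : (empiricalFreq p y x - x) ^ 2 / (x * (1 - x)) =
      ρ x * (ρ x / x) + (1 - ρ x) * ((1 - ρ x) / (1 - x)) - 1 := by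
    simp only [ρ]
    field_simp
    ring
  simp only [f, if_true, Bool.false_eq_true, if_false]
  rw [e2]
  linarith

/-! ### The growth of the potential -/

/-- The `χ²`-calibration error of a history, minus the part of its growth that is due to the
variance of the labels: in the `n`-th round with the same prediction this is at most `8 / n`. -/
noncomputable def calPotential (Z : Finset I) (t : ℕ) (h : History Z t) : ℝ :=
  ∑ x ∈ Z, (chiSq (predCount (fun s => ((h s).1 : I)) x)
    (oneCount (fun s => ((h s).1 : I)) (fun s => (h s).2) x) x -
      8 * harmonic (predCount (fun s => ((h s).1 : I)) x))

lemma predCount_snoc {Z : Finset I} {t : ℕ} (h : History Z t) (x : Z) (b : Bool) (z : I) :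
    predCount (fun s => ((Fin.snoc (α := fun _ => Z × Bool) h (x, b) s).1 : I)) z =
      predCount (fun s => ((h s).1 : I)) z + if (x : I) = z then 1 else 0 := by
  simp only [predCount, Fin.sum_univ_castSucc, Fin.snoc_castSucc, Fin.snoc_last]

lemma oneCount_snoc {Z : Finset I} {t : ℕ} (h : History Z t) (x : Z) (b : Bool) (z : I) :
    oneCount (fun s => ((Fin.snoc (α := fun _ => Z × Bool) h (x, b) s).1 : I))
        (fun s => (Fin.snoc (α := fun _ => Z × Bool) h (x, b) s).2) z =
      oneCount (fun s => ((h s).1 : I)) (fun s => (h s).2) z +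
        if (x : I) = z ∧ b = true then 1 else 0 := by
  simp only [oneCount, Fin.sum_univ_castSucc, Fin.snoc_castSucc, Fin.snoc_last]

lemma calPotential_snoc {Z : Finset I} {t : ℕ} (h : History Z t) (x : Z) (b : Bool) :
    calPotential Z (t + 1) (Fin.snoc (α := fun _ => Z × Bool) h (x, b)) =
      calPotential Z t h +
      (chiSq (predCount (fun s => ((h s).1 : I)) x + 1)
        (oneCount (fun s => ((h s).1 : I)) (fun s => (h s).2) x + if b = true then 1 else 0) x -
        chiSq (predCount (fun s => ((h s).1 : I)) x)
          (oneCount (fun s => ((h s).1 : I)) (fun s => (h s).2) x) x -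
        8 / ((predCount (fun s => ((h s).1 : I)) x : ℝ) + 1)) := by
  rw [← sub_eq_iff_eq_add', calPotential, calPotential, ← Finset.sum_sub_distrib,
    Finset.sum_eq_single_of_mem (x : I) x.2]
  · rw [predCount_snoc, oneCount_snoc]
    simp only [true_and, if_true, harmonic_succ]
    push_cast
    ring
  · intro z _ hz
    rw [predCount_snoc, oneCount_snoc]
    simp [hz.symm]

/-- Against labels with masses `a` and `b`, the grid point near the mean `a / (a + b)` keeps the
mean growth of the potential below `9 / K²`. -/
lemma exists_calPotential_snoc_le {K : ℕ} (hK : 1 ≤ K) (t : ℕ) (h : History (varianceGrid K) t)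
    (a b : ℝ) (ha : 0 ≤ a) (hb : 0 ≤ b) : ∃ x : varianceGrid K,
      a * calPotential _ (t + 1) (Fin.snoc (α := fun _ => varianceGrid K × Bool) h (x, true)) +
      b * calPotential _ (t + 1) (Fin.snoc (α := fun _ => varianceGrid K × Bool) h (x, false)) ≤
        (a + b) * (calPotential _ t h + 9 / (K : ℝ) ^ 2) := by
  -- if `a + b = 0`, then `q = 0` and any prediction works
  set q := a / (a + b) with hq
  have hq0 : 0 ≤ q := by positivity
  have hq1 : q ≤ 1 := div_le_one_of_le₀ (by linarith) (by linarith)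
  obtain ⟨x, hx, hB, hV⟩ := exists_mem_varianceGrid_near hK hq0 hq1
  obtain ⟨hx0, hx1⟩ := pos_and_lt_one_of_mem_varianceGrid hx
  refine ⟨⟨x, hx⟩, ?_⟩
  have hstep := chiSq_step (oneCount_le_predCount (fun s => ((h s).1 : I)) (fun s => (h s).2) x)
    hx0 hx1 hB hV
  have ea : a = (a + b) * q := by
    rcases (add_nonneg ha hb).eq_or_lt with h0 | h0
    · rw [← h0, zero_mul]; linarith
    · rw [hq, mul_div_cancel₀ _ h0.ne']
  have eb : b = (a + b) * (1 - q) := by linarith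
  rw [calPotential_snoc, calPotential_snoc]
  simp only [if_true, Bool.false_eq_true, if_false, add_zero]
  have hmul := mul_le_mul_of_nonneg_left hstep (add_nonneg ha hb)
  set c := a + b
  rw [ea, eb]
  linarith

lemma calPotential_zero (Z : Finset I) (h : History Z 0) : calPotential Z 0 h = 0 := by
  simp [calPotential, predCount, oneCount, chiSq]

lemma chiSqCal_le_calPotential_add {Z : Finset I} {T : ℕ} (h : History Z T) :
    chiSqCal Z (fun s => ((h s).1 : I)) (fun s => (h s).2) ≤
      calPotential Z T h + 8 * (Z.card * (1 + Real.log T)) := by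
  have hsum : ∑ x ∈ Z, (8 * harmonic (predCount (fun s => ((h s).1 : I)) x) : ℝ) ≤
      ∑ _x ∈ Z, 8 * (1 + Real.log T) := by
    refine Finset.sum_le_sum fun x _ => ?_
    have h1 : (harmonic (predCount (fun s => ((h s).1 : I)) x) : ℝ) ≤ harmonic T := by
      exact_mod_cast Finset.sum_le_sum_of_subset_of_nonneg
        (Finset.range_mono (predCount_le _ x)) fun i _ _ => by positivity
    linarith [harmonic_le_one_add_log T]
  rw [Finset.sum_const, nsmul_eq_mul] at hsum
  rw [calPotential, Finset.sum_sub_distrib, chiSqCal]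
  linarith

/-! ### The randomized forecaster -/

/-- A randomized forecaster on `varianceGrid K` whose expected `χ²`-calibration error is small
against every deterministic adversary. -/
lemma exists_forecaster_weights {K : ℕ} (hK : 1 ≤ K) (T : ℕ) :
    ∃ u ∈ stdSimplex ℝ (Forecaster (varianceGrid K) T), ∀ A,
      ∑ F, u F * chiSqCal (varianceGrid K) (predictions F A) (labels F A) ≤
        T * (9 / (K : ℝ) ^ 2) + 8 * ((varianceGrid K).card * (1 + Real.log T)) := by
  obtain ⟨x, hx, -⟩ := exists_mem_varianceGrid_near hK le_rfl zero_le_one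
  have : Nonempty (varianceGrid K) := ⟨⟨x, hx⟩⟩
  refine exists_mixed_strategy_le _ _ fun w hw => ?_
  obtain ⟨F, hF⟩ := exists_forecaster_potential_le (T := T) (calPotential (varianceGrid K)) _
    (exists_calPotential_snoc_le hK) w hw.1 T le_rfl
  refine ⟨F, ?_⟩
  rw [hw.2, calPotential_zero, zero_add, one_mul] at hF
  calc ∑ A, w A * chiSqCal (varianceGrid K) (predictions F A) (labels F A)
      ≤ ∑ A, w A * (calPotential _ T (play F A T le_rfl) +
          8 * ((varianceGrid K).card * (1 + Real.log T))) :=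
        Finset.sum_le_sum fun A _ =>
          mul_le_mul_of_nonneg_left (chiSqCal_le_calPotential_add _) (hw.1 A)
    _ = ∑ A, w A * calPotential _ T (play F A T le_rfl) +
          8 * ((varianceGrid K).card * (1 + Real.log T)) := by
        simp only [mul_add, Finset.sum_add_distrib]
        rw [← Finset.sum_mul, ← Finset.sum_mul, hw.2]
        ring
    _ ≤ _ := by linarith

lemma expectation_le {Z : Finset I} {T : ℕ} {P : PMF (Forecaster Z T)}
    {u : Forecaster Z T → ℝ} (hu : ∀ F, 0 ≤ u F) (hP : ∀ F, P F = ENNReal.ofReal (u F))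
    {W : Forecaster Z T → Adversary Z T → ℝ} (hW : ∀ F A, 0 ≤ W F A) {v : ℝ}
    (hv : ∀ A, ∑ F, u F * W F A ≤ v) {X : Forecaster Z T → Adversary Z T → EReal}
    (hX : ∀ F A, X F A ≤ (W F A : EReal)) (Q : PMF (Adversary Z T)) :
    expectation P Q X ≤ ENNReal.ofReal v := by
  have hQ : ∑ A, Q A = 1 := (tsum_fintype _).symm.trans Q.tsum_coe
  rw [expectation, tsum_fintype]
  simp_rw [tsum_fintype]
  calc ∑ F, ∑ A, P F * Q A * (X F A).toENNReal
      ≤ ∑ F, ∑ A, Q A * ENNReal.ofReal (u F * W F A) := by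
        refine Finset.sum_le_sum fun F _ => Finset.sum_le_sum fun A _ => ?_
        have := EReal.toENNReal_le_toENNReal (hX F A)
        rw [EReal.real_coe_toENNReal] at this
        rw [hP, ENNReal.ofReal_mul (hu F), mul_comm (ENNReal.ofReal (u F)), mul_assoc]
        gcongr
    _ = ∑ A, Q A * ENNReal.ofReal (∑ F, u F * W F A) := by
        rw [Finset.sum_comm]
        refine Finset.sum_congr rfl fun A _ => ?_
        rw [← Finset.mul_sum, ENNReal.ofReal_sum_of_nonneg fun F _ => mul_nonneg (hu F) (hW F A)]
    _ ≤ ∑ A, Q A * ENNReal.ofReal v :=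
        Finset.sum_le_sum fun A _ => by gcongr; exact hv A
    _ = ENNReal.ofReal v := by rw [← Finset.sum_mul, hQ, one_mul]

/-- The value of the bound for a grid with `⌈T^{1/3}⌉` points on each side of `1/2`. -/
lemma rate_le {T : ℕ} (hT : 2 ≤ T) {K n : ℕ} (hK : K = ⌈(T : ℝ) ^ (1 / 3 : ℝ)⌉₊)
    (hn : n ≤ 2 * K) :
    T * (9 / (K : ℝ) ^ 2) + 8 * (n * (1 + Real.log T)) ≤
      228 * (T : ℝ) ^ (1 / 3 : ℝ) * Real.log T ^ (5 / 3 : ℝ) := by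
  have hT' : (2 : ℝ) ≤ T := by exact_mod_cast hT
  have hT0 : (0 : ℝ) < T := by linarith
  set R : ℝ := (T : ℝ) ^ (1 / 3 : ℝ) with hR
  have hR1 : 1 ≤ R := Real.one_le_rpow (by linarith) (by norm_num)
  have hR3 : (T : ℝ) = R ^ 3 := by
    rw [hR, ← Real.rpow_natCast, ← Real.rpow_mul hT0.le]
    norm_num
  have hRK : R ≤ K := by rw [hK]; exact Nat.le_ceil R
  have hKR : (K : ℝ) ≤ 2 * R := by
    rw [hK]
    linarith [Nat.ceil_lt_add_one (show 0 ≤ R by linarith)]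
  have hn' : (n : ℝ) ≤ 4 * R := by
    have : (n : ℝ) ≤ 2 * K := by exact_mod_cast hn
    linarith
  set L := Real.log T with hL
  have hL2 : 1 / 2 ≤ L := by
    have := Real.log_le_log two_pos hT'
    linarith [Real.log_two_gt_d9]
  have hL0 : 0 < L := by linarith
  -- `log T` is at least `log 2 > 1/2`, hence `1` and `log T` are at most multiples of its power
  have hhalf : (1 / 2 : ℝ) ≤ L ^ (2 / 3 : ℝ) :=
    calc (1 / 2 : ℝ) = (1 / 2 : ℝ) ^ (1 : ℝ) := by simp
      _ ≤ (1 / 2 : ℝ) ^ (2 / 3 : ℝ) :=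
        Real.rpow_le_rpow_of_exponent_ge (by norm_num) (by norm_num) (by norm_num)
      _ ≤ L ^ (2 / 3 : ℝ) := Real.rpow_le_rpow (by norm_num) hL2 (by norm_num)
  have hpow : L ^ (5 / 3 : ℝ) = L * L ^ (2 / 3 : ℝ) := by
    rw [← Real.rpow_one_add' hL0.le (by norm_num)]
    norm_num
  have hLP : L ≤ 2 * L ^ (5 / 3 : ℝ) := by
    rw [hpow]; nlinarith
  have h1P : 1 ≤ 4 * L ^ (5 / 3 : ℝ) := by linarith
  have hfirst : T * (9 / (K : ℝ) ^ 2) ≤ 9 * R := by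
    have hK0 : (0 : ℝ) < K := by linarith
    have hK2 : R ^ 2 ≤ (K : ℝ) ^ 2 := by gcongr
    rw [← mul_div_assoc, div_le_iff₀ (by positivity), hR3]
    nlinarith
  calc T * (9 / (K : ℝ) ^ 2) + 8 * (n * (1 + L))
      ≤ 9 * R + 8 * (4 * R * (1 + L)) := by gcongr
    _ = R * (41 * 1 + 32 * L) := by ring
    _ ≤ R * (41 * (4 * L ^ (5 / 3 : ℝ)) + 32 * (2 * L ^ (5 / 3 : ℝ))) := by gcongr
    _ = 228 * R * L ^ (5 / 3 : ℝ) := by ring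

theorem mainTheorem1 :
    ∃ C : ℝ, 0 < C ∧ ∀ T : ℕ, 2 ≤ T →
      ∃ (Z : Finset unitInterval) (P : PMF (Forecaster Z T)), ∀ Q : PMF (Adversary Z T),
        expectation P Q (fun F A => swapRegret logLoss (predictions F A) (labels F A)) ≤
            ENNReal.ofReal (C * (T : ℝ) ^ (1 / 3 : ℝ) * Real.log (T : ℝ) ^ (5 / 3 : ℝ)) ∧
          expectation P Q (fun F A => klCal Z (predictions F A) (labels F A)) ≤
            ENNReal.ofReal (C * (T : ℝ) ^ (1 / 3 : ℝ) * Real.log (T : ℝ) ^ (5 / 3 : ℝ)) := by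
  refine ⟨228, by norm_num, fun T hT => ?_⟩
  obtain ⟨K, hKdef⟩ : ∃ K, K = ⌈(T : ℝ) ^ (1 / 3 : ℝ)⌉₊ := ⟨_, rfl⟩
  have hK : 1 ≤ K := by
    rw [hKdef, Nat.one_le_ceil_iff]
    positivity
  obtain ⟨u, hu, hv⟩ := exists_forecaster_weights hK T
  have hgrid : ∀ x ∈ varianceGrid K, 0 < (x : ℝ) ∧ (x : ℝ) < 1 :=
    fun x hx => pos_and_lt_one_of_mem_varianceGrid hx
  have hW (F : Forecaster (varianceGrid K) T) (A) :
      0 ≤ chiSqCal (varianceGrid K) (predictions F A) (labels F A) :=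
    Finset.sum_nonneg fun x hx => chiSq_nonneg _ _ (hgrid x hx).1 (hgrid x hx).2
  have hv' := fun A => (hv A).trans (rate_le hT hKdef (card_varianceGrid_le K))
  refine ⟨varianceGrid K, PMF.ofFintype (fun F => ENNReal.ofReal (u F)) ?_, fun Q => ⟨?_, ?_⟩⟩
  · rw [← ENNReal.ofReal_sum_of_nonneg fun F _ => hu.1 F, hu.2, ENNReal.ofReal_one]
  · exact expectation_le hu.1 (fun F => PMF.ofFintype_apply _ F) hW hv'
      (fun F A => swapRegret_le_chiSqCal hgrid _ _ fun t => (play F A T le_rfl t).1.2) Q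
  · exact expectation_le hu.1 (fun F => PMF.ofFintype_apply _ F) hW hv'
      (fun F A => klCal_le_chiSqCal hgrid _ _) Q
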